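/- A finite abstract simplicial complex $G$ is a finite set of non-empty finite sets closed under taking non-empty subsets. Let $\Gamma$ be the graph with vertex set $G$ in which two different sets are adjacent if one contains the other, and for $x\in G$ let the unit sphere $S(x)$ be the subgraph of $\Gamma$ induced on the neighbours of $x$; unit spheres in any finite simple graph are defined in the same way. Contractible graphs are defined inductively: the one-point graph is contractible, and a finite simple graph $A$ is contractible if it has a vertex $x$ such that $S(x)$ and $A-x$ are both contractible. The $(-1)$-sphere is the empty graph; for $d\ge 0$, a $d$-sphere is a finite simple graph all of whose unit spheres are $(d-1)$-spheres and which has a vertex $x$ such that removing $x$ leaves a contractible graph. There are no $(-1)$-balls; for $d\ge 0$, a $d$-ball is a contractible finite simple graph in which every unit sphere is a $(d-1)$-sphere or a $(d-1)$-ball, and in which the subgraph induced on the vertices whose unit sphere is a $(d-1)$-ball is a $(d-1)$-sphere. For $d\ge 0$, a $d$-complex with boundary (a discrete $d$-manifold with boundary) is a finite abstract simplicial complex $G$ such that for every $x\in G$ the graph $S(x)$ is a $(d-1)$-sphere or a $(d-1)$-ball. Its boundary $\delta G$ is the set of all $x\in G$ for which $S(x)$ is a $(d-1)$-ball. For a non-empty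 finite set $x$ let $\omega(x)=(-1)^{|x|-1}$, and let $$\chi(G)=\sum_{x\in G}\omega(x),\qquad \omega(G)=\sum_{\substack{(x,y)\in G\times G\\ x\cap y\ne\emptyset}}\omega(x)\,\omega(y)$$ be the Euler characteristic and the Wu characteristic. **Theorem.** Let $d\ge 0$ and let $G$ be a $d$-complex with boundary. Then $\delta G$ is a simplicial complex and $$\omega(G)=\chi(G)-\chi(\delta G).$$ Equivalently, the internal energy $E(G)=\chi(G)-\omega(G)$ satisfies $E(G)=\chi(\delta G)$. -/

import Mathlib

namespace DiscreteManifold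

section Graphs

variable {V : Type*}

/-! Throughout, a finite set `A` of vertices of an ambient graph `Γ` stands for the finite simple
graph that `Γ` induces on `A`. -/

open scoped Classical in
/-- The unit sphere `S(x)` in the graph induced on `A`: the neighbours of `x` in `A`. -/
noncomputable def unitSphere (Γ : SimpleGraph V) (A : Finset V) (x : V) : Finset V :=
  A.filter fun y => Γ.Adj x y

open scoped Classical in
/-- Contractible graphs: the one-point graph is contractible, and a graph is contractible if it
has a vertex `x` such that both `S(x)` and the graph with `x` removed are contractible. -/
inductive IsContractible (Γ : SimpleGraph V) : Finset V → Prop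
  | point (x : V) : IsContractible Γ {x}
  | step (A : Finset V) (x : V) (hx : x ∈ A) (hS : IsContractible Γ (unitSphere Γ A x))
      (hA : IsContractible Γ (A.erase x)) : IsContractible Γ A

open scoped Classical in
/-- `IsSphere Γ n A` says that the graph induced on `A` is an `(n - 1)`-sphere (the index is
shifted by one, since dimensions of spheres start at `-1`). The `(-1)`-sphere is the empty graph.
A `d`-sphere is a graph all of whose unit spheres are `(d - 1)`-spheres and which becomes
contractible after the removal of some vertex. -/
def IsSphere (Γ : SimpleGraph V) : ℕ → Finset V → Prop
  | 0, A => A = ∅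
  | n + 1, A => (∀ x ∈ A, IsSphere Γ n (unitSphere Γ A x)) ∧
      ∃ x ∈ A, IsContractible Γ (A.erase x)

open scoped Classical in
/-- `IsBall Γ n A` says that the graph induced on `A` is an `(n - 1)`-ball (the same shift as in
`IsSphere`). There is no `(-1)`-ball. A `d`-ball is a contractible graph in which every unit sphere
is a `(d - 1)`-sphere or a `(d - 1)`-ball, and whose boundary, the graph induced on the vertices
for which the unit sphere is a `(d - 1)`-ball, is a `(d - 1)`-sphere. -/
def IsBall (Γ : SimpleGraph V) : ℕ → Finset V → Prop
  | 0, _ => False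
  | n + 1, A => IsContractible Γ A ∧
      (∀ x ∈ A, IsSphere Γ n (unitSphere Γ A x) ∨ IsBall Γ n (unitSphere Γ A x)) ∧
      IsSphere Γ n (A.filter fun x => IsBall Γ n (unitSphere Γ A x))

end Graphs

section Complexes

variable {ι : Type*}

/-- A finite abstract simplicial complex: a finite set of non-empty finite sets that is closed
under taking non-empty subsets. -/
def IsComplex (G : Finset (Finset ι)) : Prop :=
  ∃ K : PreAbstractSimplicialComplex ι, K.faces = (G : Set (Finset ι))

/-- Two different sets are adjacent if one is contained in the other. The graph induced on a
complex `G` is the graph whose Whitney complex is the Barycentric refinement of `G`. -/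
def inclusionGraph (ι : Type*) : SimpleGraph (Finset ι) where
  Adj x y := x ⊂ y ∨ y ⊂ x
  symm := ⟨fun _ _ h => h.symm⟩
  loopless := ⟨fun x h => h.elim (ssubset_irrefl x) (ssubset_irrefl x)⟩

/-- A complex with boundary of dimension `d` (discrete `d`-manifold with boundary): every unit
sphere `S(x)`, `x ∈ G`, is a `(d - 1)`-sphere or a `(d - 1)`-ball. -/
def IsComplexWithBoundary (d : ℕ) (G : Finset (Finset ι)) : Prop :=
  IsComplex G ∧ ∀ x ∈ G,
    IsSphere (inclusionGraph ι) d (unitSphere (inclusionGraph ι) G x) ∨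
    IsBall (inclusionGraph ι) d (unitSphere (inclusionGraph ι) G x)

open scoped Classical in
/-- The boundary `δG` of a `d`-complex with boundary: the sets `x ∈ G` for which `S(x)` is a
`(d - 1)`-ball. -/
noncomputable def boundary (d : ℕ) (G : Finset (Finset ι)) : Finset (Finset ι) :=
  G.filter fun x => IsBall (inclusionGraph ι) d (unitSphere (inclusionGraph ι) G x)

/-- `ω(x) = (-1) ^ dim x` with `dim x = |x| - 1` (`x` is non-empty). -/
def sign (x : Finset ι) : ℤ := (-1) ^ (x.card - 1)

/-- The Euler characteristic `χ(G)`. -/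
def eulerChar (G : Finset (Finset ι)) : ℤ := ∑ x ∈ G, sign x

open scoped Classical in
/-- The Wu characteristic: the sum of `ω(x) ω(y)` over all ordered pairs of intersecting sets
`x, y ∈ G` (including `x = y`). -/
noncomputable def wuChar (G : Finset (Finset ι)) : ℤ :=
  ∑ x ∈ G, ∑ y ∈ G with (x ∩ y).Nonempty, sign x * sign y

/-- The internal energy `E(G) = χ(G) - ω(G)`. -/
noncomputable def internalEnergy (G : Finset (Finset ι)) : ℤ := eulerChar G - wuChar G

end Complexes

end DiscreteManifold

/-! Let `e(A)` denote one minus the Euler characteristic of the Whitney complex of a graph `A`.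
Removing a vertex `x` gives `e(A) = e(A - x) - e(S(x))`, so `e` vanishes on contractible graphs,
hence on balls, equals `±1` on spheres, and is multiplicative on joins.

Every simplex `z` of a complex `G` satisfies `∑_{x ⊇ z} ω(x) = e(S(z))`: the unit sphere `S(z)` is
the join of the proper faces of `z` and the proper cofaces of `z`, and Philip Hall's theorem
computes `e` of the two parts through the Möbius function of the Boolean lattice. Since
`∑_{∅ ≠ z ⊆ x ∩ y} ω(z)` is the indicator of `x ∩ y ≠ ∅`, expanding the squares yields
`ω(G) = ∑_z ω(z) e(S(z))²`. The factor `e(S(z))²` is `0` on the boundary and `1` off it.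

The boundary is closed under faces: if `S(y)` were a sphere for a face `y` of a boundary simplex
`x`, then `e` would be nonzero on the unit sphere of `x` in `S(y)`, which has the cofaces of `x` as
a join factor; but `e(S(x)) = 0` forces `e` to vanish on these cofaces. -/

namespace DiscreteManifold

section Graphs

variable {V : Type*} {Γ : SimpleGraph V} {A B : Finset V} {x y : V} {n : ℕ}

theorem mem_unitSphere : y ∈ unitSphere Γ A x ↔ y ∈ A ∧ Γ.Adj x y := by
  simp [unitSphere]

theorem unitSphere_subset : unitSphere Γ A x ⊆ A :=
  fun _ hy => (mem_unitSphere.1 hy).1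

theorem self_notMem_unitSphere : x ∉ unitSphere Γ A x :=
  fun h => Γ.irrefl (mem_unitSphere.1 h).2

theorem unitSphere_ssubset (hx : x ∈ A) : unitSphere Γ A x ⊂ A :=
  (Finset.ssubset_iff_of_subset unitSphere_subset).2 ⟨x, hx, self_notMem_unitSphere⟩

open scoped Classical in
/-- The cliques of the graph induced on `A`, including the empty one: the simplices of its Whitney
complex together with `∅`. -/
noncomputable def cliques (Γ : SimpleGraph V) (A : Finset V) : Finset (Finset V) :=
  A.powerset.filter fun c => Γ.IsClique c

theorem mem_cliques {c : Finset V} : c ∈ cliques Γ A ↔ c ⊆ A ∧ Γ.IsClique c := by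
  simp [cliques]

theorem insert_mem_cliques_iff [DecidableEq V] {c : Finset V} (hx : x ∈ A) (hc : x ∉ c) :
    insert x c ∈ cliques Γ A ↔ c ∈ cliques Γ (unitSphere Γ A x) := by
  simp only [mem_cliques, Finset.subset_iff, Finset.mem_insert, mem_unitSphere,
    Finset.coe_insert, SimpleGraph.isClique_insert, Finset.mem_coe]
  grind

/-- The sum of `(-1) ^ |c|` over all cliques `c` of the graph induced on `A`. The empty clique
counts, so this is one minus the Euler characteristic of the Whitney complex. -/
noncomputable def cliqueSum (Γ : SimpleGraph V) (A : Finset V) : ℤ :=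
  ∑ c ∈ cliques Γ A, (-1) ^ c.card

theorem cliqueSum_empty : cliqueSum Γ ∅ = 1 := by
  simp [cliqueSum, cliques, Finset.filter_singleton]

theorem sum_cliques_mem [DecidableEq V] (hx : x ∈ A) :
    ∑ c ∈ cliques Γ A with x ∈ c, (-1) ^ c.card = -cliqueSum Γ (unitSphere Γ A x) := by
  have x_notMem {c : Finset V} (hc : c ∈ cliques Γ (unitSphere Γ A x)) : x ∉ c :=
    fun h => self_notMem_unitSphere ((mem_cliques.1 hc).1 h)
  rw [cliqueSum, ← Finset.sum_neg_distrib]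
  refine Finset.sum_nbij' (·.erase x) (insert x) ?_ ?_ ?_ ?_ ?_
  · intro c hc
    obtain ⟨hcA, hxc⟩ := Finset.mem_filter.1 hc
    rwa [← insert_mem_cliques_iff hx (Finset.notMem_erase x c), Finset.insert_erase hxc]
  · intro c hc
    exact Finset.mem_filter.2
      ⟨(insert_mem_cliques_iff hx (x_notMem hc)).2 hc, Finset.mem_insert_self x c⟩
  · exact fun c hc => Finset.insert_erase (Finset.mem_filter.1 hc).2
  · exact fun c hc => Finset.erase_insert (x_notMem hc)
  · intro c hc
    rw [← Finset.card_erase_add_one (Finset.mem_filter.1 hc).2, pow_succ]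
    ring

theorem cliqueSum_eq_erase_sub [DecidableEq V] (hx : x ∈ A) :
    cliqueSum Γ A = cliqueSum Γ (A.erase x) - cliqueSum Γ (unitSphere Γ A x) := by
  have cliques_notMem : {c ∈ cliques Γ A | x ∉ c} = cliques Γ (A.erase x) := by
    ext c
    simp only [Finset.mem_filter, mem_cliques, Finset.subset_erase]
    tauto
  rw [cliqueSum, ← Finset.sum_filter_add_sum_filter_not _ (x ∈ ·), sum_cliques_mem hx,
    cliques_notMem, ← cliqueSum, neg_add_eq_sub]

theorem cliqueSum_union [DecidableEq V] (h : ∀ a ∈ A, ∀ b ∈ B, Γ.Adj a b) :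
    cliqueSum Γ (A ∪ B) = cliqueSum Γ A * cliqueSum Γ B := by
  induction A using Finset.strongInduction with
  | H A ih =>
    obtain rfl | ⟨x, hx⟩ := A.eq_empty_or_nonempty
    · rw [Finset.empty_union, cliqueSum_empty, one_mul]
    have hxB : x ∉ B := fun hb => Γ.irrefl (h x hx x hb)
    have hS : unitSphere Γ (A ∪ B) x = unitSphere Γ A x ∪ B := by
      ext y
      simp only [mem_unitSphere, Finset.mem_union]
      have := h x hx y
      tauto
    rw [cliqueSum_eq_erase_sub (Finset.mem_union_left B hx), hS,
      Finset.erase_union_distrib, Finset.erase_eq_of_notMem hxB,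
      ih _ (Finset.erase_ssubset hx) fun a ha => h a (Finset.mem_of_mem_erase ha),
      ih _ (unitSphere_ssubset hx) fun a ha => h a (unitSphere_subset ha),
      cliqueSum_eq_erase_sub hx, sub_mul]

theorem IsContractible.cliqueSum_eq_zero (h : IsContractible Γ A) : cliqueSum Γ A = 0 := by
  classical
  induction h with
  | point x =>
    have hS : unitSphere Γ {x} x = ∅ :=
      (Finset.subset_singleton_iff.1 unitSphere_subset).resolve_right fun h =>
        self_notMem_unitSphere (h ▸ Finset.mem_singleton_self x)
    rw [cliqueSum_eq_erase_sub (Finset.mem_singleton_self x), hS, Finset.erase_singleton, sub_self]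
  | step A x hx _ _ sphere_eq_zero erase_eq_zero =>
    rw [cliqueSum_eq_erase_sub hx, sphere_eq_zero, sub_zero]
    convert erase_eq_zero

theorem IsSphere.cliqueSum_eq (h : IsSphere Γ n A) : cliqueSum Γ A = (-1) ^ n := by
  induction n generalizing A with
  | zero =>
    obtain rfl : A = ∅ := h
    rw [cliqueSum_empty, pow_zero]
  | succ n ih =>
    classical
    obtain ⟨hS, x, hx, hc⟩ := h
    rw [cliqueSum_eq_erase_sub hx, hc.cliqueSum_eq_zero, ih (hS x hx), pow_succ]
    ring

theorem IsSphere.cliqueSum_unitSphere_ne_zero (h : IsSphere Γ n A) (hx : x ∈ A) :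
    cliqueSum Γ (unitSphere Γ A x) ≠ 0 := by
  cases n with
  | zero =>
    obtain rfl : A = ∅ := h
    exact absurd hx (Finset.notMem_empty x)
  | succ n =>
    rw [(h.1 x hx).cliqueSum_eq]
    exact pow_ne_zero _ (by norm_num)

theorem IsBall.cliqueSum_eq_zero (h : IsBall Γ n A) : cliqueSum Γ A = 0 := by
  cases n with
  | zero => exact h.elim
  | succ n => exact h.1.cliqueSum_eq_zero

end Graphs

section Posets

open IncidenceAlgebra (mu)

/-- The comparability graph of a preorder, in which distinct comparable elements are adjacent.
On finite sets it is definitionally `inclusionGraph`. -/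
def comparabilityGraph (α : Type*) [Preorder α] : SimpleGraph α where
  Adj x y := x < y ∨ y < x
  symm := ⟨fun _ _ h => h.symm⟩
  loopless := ⟨fun x h => h.elim (lt_irrefl x) (lt_irrefl x)⟩

theorem cliqueSum_unitSphere_comparabilityGraph {α : Type*} [Preorder α] [DecidableLT α]
    (A : Finset α) (x : α) :
    cliqueSum (comparabilityGraph α) (unitSphere (comparabilityGraph α) A x) =
      cliqueSum (comparabilityGraph α) {y ∈ A | y < x} *
        cliqueSum (comparabilityGraph α) {y ∈ A | x < y} := by
  classical
  have hS : unitSphere (comparabilityGraph α) A x = {y ∈ A | y < x} ∪ {y ∈ A | x < y} := by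
    ext y
    simp only [mem_unitSphere, comparabilityGraph, Finset.mem_union, Finset.mem_filter]
    tauto
  rw [hS]
  exact cliqueSum_union fun a ha b hb =>
    Or.inl ((Finset.mem_filter.1 ha).2.trans (Finset.mem_filter.1 hb).2)

variable {α : Type*} [PartialOrder α]

theorem isRelLowerSet_erase_of_maximal [DecidableEq α] {P : α → Prop} {A : Finset α} {x : α}
    (hA : IsRelLowerSet (A : Set α) P) (hx : Maximal (· ∈ A) x) :
    IsRelLowerSet (A.erase x : Set α) P := by
  intro y hy
  obtain ⟨hyx, hyA⟩ := Finset.mem_erase.1 (Finset.mem_coe.1 hy)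
  refine ⟨hA.prop_of_mem hyA, fun w hwy hw =>
    Finset.mem_coe.2 (Finset.mem_erase.2 ⟨?_, hA.mem_of_le hyA hwy hw⟩)⟩
  rintro rfl
  exact hyx (hx.eq_of_ge hyA hwy)

variable [LocallyFiniteOrder α]

theorem isRelLowerSet_Ioo (z x : α) : IsRelLowerSet (Finset.Ioo z x : Set α) (z < ·) := by
  rw [Finset.coe_Ioo]
  exact fun y hy => ⟨hy.1, fun w hwy hzw => ⟨hzw, hwy.trans_lt hy.2⟩⟩

theorem unitSphere_comparabilityGraph_of_maximal {A : Finset α} {z x : α}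
    (hA : IsRelLowerSet (A : Set α) (z < ·)) (hx : Maximal (· ∈ A) x) :
    unitSphere (comparabilityGraph α) A x = Finset.Ioo z x := by
  ext y
  rw [mem_unitSphere, Finset.mem_Ioo]
  constructor
  · rintro ⟨hy, hxy | hyx⟩
    · exact absurd hxy (hx.not_gt hy)
    · exact ⟨hA.prop_of_mem hy, hyx⟩
  · rintro ⟨hzy, hyx⟩
    exact ⟨hA.mem_of_le hx.prop hyx.le hzy, Or.inr hyx⟩

variable [DecidableEq α]

theorem one_add_sum_Ioo_mu {z x : α} (h : z < x) :
    1 + ∑ y ∈ Finset.Ioo z x, mu ℤ z y = -mu ℤ z x := by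
  rw [IncidenceAlgebra.mu_eq_neg_sum_Ico_of_ne h.ne, neg_neg, ← Finset.add_sum_Ioo_eq_sum_Ico h,
    IncidenceAlgebra.mu_self]

/-- Philip Hall's theorem. Removing a maximal element `x` of `A` removes the term `μ(z, x)` from
the sum and, by induction on the unit sphere `Ioo z x`, the same amount from the clique sum. -/
theorem cliqueSum_eq_one_add_sum_mu {z : α} {A : Finset α}
    (hA : IsRelLowerSet (A : Set α) (z < ·)) :
    cliqueSum (comparabilityGraph α) A = 1 + ∑ x ∈ A, mu ℤ z x := by
  induction A using Finset.strongInduction with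
  | H A ih =>
    obtain rfl | hne := A.eq_empty_or_nonempty
    · rw [cliqueSum_empty, Finset.sum_empty, add_zero]
    obtain ⟨x, hx⟩ := A.exists_maximal hne
    have hS := unitSphere_comparabilityGraph_of_maximal hA hx
    have hIoo : Finset.Ioo z x ⊂ A := hS ▸ unitSphere_ssubset hx.prop
    rw [cliqueSum_eq_erase_sub hx.prop, hS, ih _ hIoo (isRelLowerSet_Ioo z x),
      one_add_sum_Ioo_mu (hA.prop_of_mem hx.prop),
      ih _ (Finset.erase_ssubset hx.prop) (isRelLowerSet_erase_of_maximal hA hx),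
      ← Finset.sum_erase_add A _ hx.prop]
    ring

theorem cliqueSum_Ioo {z x : α} (h : z < x) :
    cliqueSum (comparabilityGraph α) (Finset.Ioo z x) = -mu ℤ z x := by
  rw [cliqueSum_eq_one_add_sum_mu (isRelLowerSet_Ioo z x), one_add_sum_Ioo_mu h]

end Posets

section BooleanLattice

open IncidenceAlgebra (mu)

variable {ι : Type*} [DecidableEq ι] {x z : Finset ι}

theorem sum_Icc_neg_one_pow_card_sdiff (h : z ⊂ x) :
    ∑ y ∈ Finset.Icc z x, (-1 : ℤ) ^ (y \ z).card = 0 := by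
  rw [← Finset.sum_powerset_neg_one_pow_card_of_nonempty (Finset.sdiff_nonempty.2 h.2)]
  refine Finset.sum_nbij' (· \ z) (z ∪ ·) ?_ ?_ ?_ ?_ fun _ _ => rfl
  · intro y hy
    exact Finset.mem_powerset.2 (Finset.sdiff_subset_sdiff (Finset.mem_Icc.1 hy).2 subset_rfl)
  · intro w hw
    exact Finset.mem_Icc.2 ⟨Finset.subset_union_left, Finset.union_subset h.1
      ((Finset.mem_powerset.1 hw).trans Finset.sdiff_subset)⟩
  · exact fun y hy => Finset.union_sdiff_of_subset (Finset.mem_Icc.1 hy).1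
  · exact fun w hw => Finset.union_sdiff_cancel_left
      (Finset.disjoint_sdiff.mono_right (Finset.mem_powerset.1 hw))

theorem mu_eq_neg_one_pow_card_sdiff (h : z ⊆ x) : mu ℤ z x = (-1) ^ (x \ z).card := by
  induction x using Finset.strongInduction with
  | H x ih =>
    obtain rfl | hzx := h.eq_or_ssubset
    · simp
    have hIco : ∑ y ∈ Finset.Ico z x, mu ℤ z y = ∑ y ∈ Finset.Ico z x, (-1) ^ (y \ z).card :=
      Finset.sum_congr rfl fun y hy => ih y (Finset.mem_Ico.1 hy).2 (Finset.mem_Ico.1 hy).1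
    rw [IncidenceAlgebra.mu_eq_neg_sum_Ico_of_ne hzx.ne, hIco, neg_eq_iff_add_eq_zero,
      Finset.sum_Ico_add_eq_sum_Icc h, sum_Icc_neg_one_pow_card_sdiff hzx]

theorem sign_eq_neg_mu (hx : x.Nonempty) : sign x = -mu ℤ ∅ x := by
  obtain ⟨n, hn⟩ := Nat.exists_eq_succ_of_ne_zero hx.card_ne_zero
  simp [sign, mu_eq_neg_one_pow_card_sdiff (Finset.empty_subset x), hn, pow_succ]

theorem sign_eq_sign_mul_mu (hz : z.Nonempty) (h : z ⊆ x) : sign x = sign z * mu ℤ z x := by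
  have hcard := Finset.card_sdiff_add_card_eq_card h
  have hpos := hz.card_pos
  rw [mu_eq_neg_one_pow_card_sdiff h, sign, sign, ← pow_add]
  congr 1
  lia

theorem sum_Ioc_empty_sign (s : Finset ι) :
    ∑ z ∈ Finset.Ioc ∅ s, sign z = if s.Nonempty then 1 else 0 := by
  have hIcc := IncidenceAlgebra.sum_Icc_mu_right (𝕜 := ℤ) ∅ s
  rw [← Finset.sum_Ioc_add_eq_sum_Icc (Finset.empty_subset s), IncidenceAlgebra.mu_self] at hIcc
  rw [Finset.sum_congr rfl fun z hz => sign_eq_neg_mu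
    (Finset.empty_ssubset.1 (Finset.mem_Ioc.1 hz).1), Finset.sum_neg_distrib,
    eq_sub_of_add_eq hIcc, neg_sub]
  obtain rfl | hs := s.eq_empty_or_nonempty
  · simp
  · simp [hs, hs.ne_empty.symm]

end BooleanLattice

section Complexes

variable {ι : Type*} {G : Finset (Finset ι)} {d : ℕ} {x y z : Finset ι}

theorem isComplex_iff_isRelLowerSet :
    IsComplex G ↔ IsRelLowerSet (G : Set (Finset ι)) Finset.Nonempty :=
  ⟨fun ⟨K, hK⟩ => hK ▸ K.isRelLowerSet_faces, fun h => ⟨⟨G, h⟩, rfl⟩⟩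

theorem IsComplex.nonempty_of_mem (hG : IsComplex G) (hx : x ∈ G) : x.Nonempty :=
  (isComplex_iff_isRelLowerSet.1 hG).prop_of_mem hx

theorem IsComplex.mem_of_subset (hG : IsComplex G) (hx : x ∈ G) (hyx : y ⊆ x) (hy : y.Nonempty) :
    y ∈ G :=
  (isComplex_iff_isRelLowerSet.1 hG).mem_of_le hx hyx hy

theorem IsComplex.cliqueSum_faces [DecidableEq ι] (hG : IsComplex G) (hz : z ∈ G) :
    cliqueSum (inclusionGraph ι) {y ∈ G | y ⊂ z} = sign z := by
  have hIoo : {y ∈ G | y ⊂ z} = Finset.Ioo ∅ z := by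
    ext y
    rw [Finset.mem_filter, Finset.mem_Ioo, Finset.empty_ssubset]
    exact and_congr_left fun hy => ⟨hG.nonempty_of_mem, hG.mem_of_subset hz hy.1⟩
  rw [hIoo, sign_eq_neg_mu (hG.nonempty_of_mem hz)]
  exact cliqueSum_Ioo (Finset.empty_ssubset.2 (hG.nonempty_of_mem hz))

theorem IsComplex.sign_mul_cliqueSum_cofaces [DecidableEq ι] (hG : IsComplex G) (hz : z ∈ G) :
    sign z * cliqueSum (inclusionGraph ι) {x ∈ G | z ⊂ x} = ∑ x ∈ G with z ⊆ x, sign x := by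
  have hlower : IsRelLowerSet ({x ∈ G | z ⊂ x} : Finset (Finset ι)) (z ⊂ ·) := fun x hx => by
    obtain ⟨hxG, hzx⟩ := Finset.mem_filter.1 (Finset.mem_coe.1 hx)
    exact ⟨hzx, fun y hyx hzy => Finset.mem_coe.2 (Finset.mem_filter.2
      ⟨hG.mem_of_subset hxG hyx ((hG.nonempty_of_mem hz).mono hzy.1), hzy⟩)⟩
  have hstar : {x ∈ G | z ⊆ x} = insert z {x ∈ G | z ⊂ x} := by
    ext x
    simp only [Finset.mem_filter, Finset.mem_insert, Finset.ssubset_iff_subset_ne]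
    grind
  have hHall : cliqueSum (inclusionGraph ι) {x ∈ G | z ⊂ x} =
      1 + ∑ x ∈ G with z ⊂ x, IncidenceAlgebra.mu ℤ z x := cliqueSum_eq_one_add_sum_mu hlower
  rw [hHall, hstar, Finset.sum_insert (by simp), mul_add, mul_one, Finset.mul_sum]
  exact congrArg _ (Finset.sum_congr rfl fun x hx =>
    (sign_eq_sign_mul_mu (hG.nonempty_of_mem hz) (Finset.mem_filter.1 hx).2.1).symm)

theorem IsComplex.cliqueSum_unitSphere [DecidableEq ι] (hG : IsComplex G) (hz : z ∈ G) :
    cliqueSum (inclusionGraph ι) (unitSphere (inclusionGraph ι) G z) =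
      sign z * cliqueSum (inclusionGraph ι) {x ∈ G | z ⊂ x} := by
  rw [← hG.cliqueSum_faces hz]
  exact cliqueSum_unitSphere_comparabilityGraph G z

theorem IsComplex.sum_sign_common_faces [DecidableEq ι] (hG : IsComplex G) (hx : x ∈ G)
    (y : Finset ι) :
    ∑ z ∈ G with z ⊆ x ∧ z ⊆ y, sign z = if (x ∩ y).Nonempty then 1 else 0 := by
  rw [← sum_Ioc_empty_sign]
  refine Finset.sum_congr (Finset.ext fun z => ?_) fun _ _ => rfl
  rw [Finset.mem_filter, Finset.mem_Ioc, Finset.empty_ssubset, Finset.subset_inter_iff]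
  exact and_congr_left fun hz => ⟨hG.nonempty_of_mem, hG.mem_of_subset hx hz.1⟩

theorem IsComplex.wuChar_eq_sum_sign_mul_sq_sum_cofaces [DecidableEq ι] (hG : IsComplex G) :
    wuChar G = ∑ z ∈ G, sign z * (∑ x ∈ G with z ⊆ x, sign x) ^ 2 := by
  calc wuChar G
      = ∑ x ∈ G, ∑ y ∈ G, ∑ z ∈ G with z ⊆ x ∧ z ⊆ y, sign z * (sign x * sign y) := by
        refine Finset.sum_congr rfl fun x hx => ?_
        rw [Finset.sum_filter]
        refine Finset.sum_congr rfl fun y _ => ?_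
        rw [← Finset.sum_mul, hG.sum_sign_common_faces hx y, ite_mul, one_mul, zero_mul]
        congr!
    _ = ∑ x ∈ G, ∑ z ∈ G with z ⊆ x, ∑ y ∈ G with z ⊆ y, sign z * (sign x * sign y) :=
        Finset.sum_congr rfl fun x _ => Finset.sum_comm' (by simp only [Finset.mem_filter]; tauto)
    _ = ∑ z ∈ G, ∑ x ∈ G with z ⊆ x, ∑ y ∈ G with z ⊆ y, sign z * (sign x * sign y) :=
        Finset.sum_comm' (by simp only [Finset.mem_filter]; tauto)
    _ = ∑ z ∈ G, sign z * (∑ x ∈ G with z ⊆ x, sign x) ^ 2 := by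
        simp_rw [sq, Finset.sum_mul_sum, Finset.mul_sum]

theorem IsComplex.wuChar_eq_sum_sign_mul_sq_cliqueSum (hG : IsComplex G) :
    wuChar G = ∑ z ∈ G,
      sign z * cliqueSum (inclusionGraph ι) (unitSphere (inclusionGraph ι) G z) ^ 2 := by
  classical
  rw [hG.wuChar_eq_sum_sign_mul_sq_sum_cofaces]
  refine Finset.sum_congr rfl fun z hz => ?_
  rw [hG.cliqueSum_unitSphere hz, hG.sign_mul_cliqueSum_cofaces hz]

theorem mem_boundary :
    x ∈ boundary d G ↔
      x ∈ G ∧ IsBall (inclusionGraph ι) d (unitSphere (inclusionGraph ι) G x) := by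
  simp [boundary]

theorem boundary_subset : boundary d G ⊆ G :=
  fun _ hx => (mem_boundary.1 hx).1

theorem IsComplexWithBoundary.isSphere_of_notMem_boundary (hG : IsComplexWithBoundary d G)
    (hx : x ∈ G) (hb : x ∉ boundary d G) :
    IsSphere (inclusionGraph ι) d (unitSphere (inclusionGraph ι) G x) :=
  (hG.2 x hx).resolve_right fun h => hb (mem_boundary.2 ⟨hx, h⟩)

theorem IsComplex.cliqueSum_cofaces_eq_zero_of_mem_boundary [DecidableEq ι] (hG : IsComplex G)
    (hx : x ∈ boundary d G) : cliqueSum (inclusionGraph ι) {w ∈ G | x ⊂ w} = 0 := by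
  obtain ⟨hxG, hball⟩ := mem_boundary.1 hx
  have hS := hG.cliqueSum_unitSphere hxG
  rw [hball.cliqueSum_eq_zero] at hS
  exact (mul_eq_zero.1 hS.symm).resolve_left (pow_ne_zero _ (by norm_num))

theorem IsComplexWithBoundary.isComplex_boundary (hG : IsComplexWithBoundary d G) :
    IsComplex (boundary d G) := by
  classical
  refine isComplex_iff_isRelLowerSet.2 fun x hx => ?_
  have hxG : x ∈ G := boundary_subset hx
  refine ⟨hG.1.nonempty_of_mem hxG, fun y hyx hy => by_contra fun hyb => ?_⟩
  have hyx : y ⊂ x := lt_of_le_of_ne hyx (by rintro rfl; exact hyb hx)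
  have hsphere := hG.isSphere_of_notMem_boundary (hG.1.mem_of_subset hxG hyx.1 hy) hyb
  have hxS : x ∈ unitSphere (inclusionGraph ι) G y := mem_unitSphere.2 ⟨hxG, Or.inl hyx⟩
  have hcofaces : {w ∈ unitSphere (inclusionGraph ι) G y | x ⊂ w} = {w ∈ G | x ⊂ w} := by
    ext w
    simp only [Finset.mem_filter, mem_unitSphere]
    exact and_congr_left fun hxw => and_iff_left (Or.inl (hyx.trans hxw))
  refine hsphere.cliqueSum_unitSphere_ne_zero hxS ?_
  refine (cliqueSum_unitSphere_comparabilityGraph _ x).trans (mul_eq_zero_of_right _ ?_)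
  exact (congrArg _ hcofaces).trans (hG.1.cliqueSum_cofaces_eq_zero_of_mem_boundary hx)

theorem IsComplexWithBoundary.wuChar_eq (hG : IsComplexWithBoundary d G) :
    wuChar G = eulerChar G - eulerChar (boundary d G) := by
  classical
  rw [hG.1.wuChar_eq_sum_sign_mul_sq_cliqueSum, eulerChar, eulerChar,
    ← Finset.sum_sdiff_eq_sub boundary_subset]
  symm
  refine Finset.sum_subset_zero_on_sdiff Finset.sdiff_subset ?_ ?_
  · intro z hz
    have hzb : z ∈ boundary d G := by simpa [boundary_subset] using hz
    rw [(mem_boundary.1 hzb).2.cliqueSum_eq_zero]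
    ring
  · intro z hz
    obtain ⟨hzG, hzb⟩ := Finset.mem_sdiff.1 hz
    rw [(hG.isSphere_of_notMem_boundary hzG hzb).cliqueSum_eq, ← pow_mul, pow_mul', neg_one_sq,
      one_pow, mul_one]

end Complexes

end DiscreteManifold

theorem mainTheorem10 {ι : Type*} (d : ℕ) (G : Finset (Finset ι))
    (hG : DiscreteManifold.IsComplexWithBoundary d G) :
    DiscreteManifold.IsComplex (DiscreteManifold.boundary d G) ∧
    DiscreteManifold.wuChar G =
      DiscreteManifold.eulerChar G
        - DiscreteManifold.eulerChar (DiscreteManifold.boundary d G) ∧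
    DiscreteManifold.internalEnergy G =
      DiscreteManifold.eulerChar (DiscreteManifold.boundary d G) := by
  refine ⟨hG.isComplex_boundary, hG.wuChar_eq, ?_⟩
  rw [DiscreteManifold.internalEnergy, hG.wuChar_eq, sub_sub_cancel]
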